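/- Let $n\ge 1$, $m\ge 1$, and write $x=(x',x_n)\in\mathbb R^{n-1}\times\mathbb R$. Define $P_1(y_1,t)=t-y_1$ and, for $k\ge 1$, $$P_{k+1}(y_1,\dots,y_{k+1},t)=P_k\big(a_1,\dots,a_k,(t-(y_1+\cdots+y_{k+1}))^2\big),\qquad a_j=y_{j+1}(y_1+\cdots+y_j).$$ For $k\ge 2$ put $C_k=1-\sqrt{\tfrac{k-1}{k}}$, $\ell(k)=(k+1)2^{k-1}-k^2+k$ and $$Q_k(y_1,\dots,y_k,t)=\Big(\frac t{C_k}+y_k\Big)^{\ell(k)}(y_1\cdots y_k)^{2^{k-1}}P_k\Big(y_1,\dots,y_{k-1},\frac1{y_1\cdots y_k},t\Big),$$ which is a polynomial because $P_k$ is homogeneous of degree $2^{k-1}$. Let $g=(g_1,\dots,g_{m+1})$ be a tuple of polynomials in $\mathbb R[x_1,\dots,x_{n-1}]$ with $g_{m+1}>1$ on $\mathbb R^{n-1}$. Consider the polynomial $$Q_g(x',x_n)=g_{m+1}(x')^{2\ell(m+1)+2^{m+1}}\,Q_{m+1}\Big(g_1(x'),\dots,g_m(x'),1,\frac{C_{m+1}x_n^2}{g_{m+1}(x')^2}\Big)\in\mathbb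 R[x_1,\dots,x_n]$$ and the sets $$A_g=\{x\in\mathbb R^n: g_1(x')>0,\dots,g_m(x')>0,\ x_n=0\},\qquad S_g=\{x+\lambda e_n:\ Q_g(x)\le 0,\ x_n>0,\ \lambda\ge 0\},$$ where $e_n=(0,\dots,0,1)$. Write $A_g+\mathbb Re_n$ and $A_g+\mathbb R_{\ge0}e_n$ for the vertical cylinder and the positive vertical cylinder over $A_g$. Theorem 3.5. Let $h\in\mathbb R[x_1,\dots,x_{n-1}]$ and $P\in\mathbb R[x_1,\dots,x_n]$ be such that $h(x')\ge0$ and $g_{m+1}(x')>h(x')$ for every $(x',0)\in A_g$, and $P>1$ on $S_g$. Define $f=(f_1,\dots,f_n):\mathbb R^n\to\mathbb R^n$ by $$f(x)=\big(x',\ x_n(1+P(x)Q_g(x))^2+h(x')(P(x)Q_g(x))^2\big).$$ Then: (i) $(A_g+\mathbb Re_n)\cap\{x_n\ge h(x')\}\subset f(S_g)\subset(A_g+\mathbb Re_n)\cap\{2x_n\ge h(x')\}$. In particular, if $h=0$, then $f(S_g)=A_g+\mathbb R_{\ge0}e_n$. (ii) If $x_n\ge0$, $P(x)Q_g(x)\ge0$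 and $h(x')\ge0$, then $f_n(x)\ge x_n$. In particular, these three hypotheses hold, and hence $f_n(x)\ge x_n$, for every $x\in\big((A_g+\mathbb R_{\ge0}e_n)\setminus S_g\big)\cap\{P\ge0\}$. (iii) If $x'\in\mathbb R^{n-1}$ is such that $h(x')\ge0$ and $P(x',x_n)\ge0$ for all large enough $x_n$, then $\lim_{x_n\to+\infty}f_n(x',x_n)=+\infty$. -/

import Mathlib

namespace Pecker

/-! ### Pecker's polynomials

Points of `ℝⁿ` with `n = d + 1` are functions `x : Fin (d + 1) → ℝ`; the first `d` coordinates
`x'` of `x` are `Fin.init x`, the last coordinate `x_n` is `x (Fin.last d)`.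
`ℝ[x']` is `MvPolynomial (Fin d) ℝ` and `ℝ[x]` is `MvPolynomial (Fin (d + 1)) ℝ`.
Tuples are indexed from `0`. The polynomials with integer or real coefficients in `y_1, …, y_{m+1}, t`
below are given through their values in an arbitrary commutative ring (or `ℝ`-algebra), so that they
can be evaluated at numbers and at polynomials alike. -/

/-- `a_k(y_1, …, y_{k+1}) = y_{k+1} (y_1 + ⋯ + y_k)` for `k = 1, …, m + 1`. -/
def auxA {R : Type*} [CommRing R] {m : ℕ} (y : Fin (m + 2) → R) (k : Fin (m + 1)) : R :=
  y k.succ * ∑ i ∈ Finset.Iic k.castSucc, y i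

/-- `peckerP m y t` is Pecker's polynomial `P_{m+1}(y_1, …, y_{m+1}, t)`, with
`P_1(y_1, t) = t - y_1` and
`P_{m+1}(y_1, …, y_{m+1}, t) = P_m(a_1, …, a_m, (t - (y_1 + ⋯ + y_{m+1}))²)`. -/
def peckerP {R : Type*} [CommRing R] : (m : ℕ) → (Fin (m + 1) → R) → R → R
  | 0, y, t => t - y 0
  | m + 1, y, t => peckerP m (auxA y) ((t - ∑ i, y i) ^ 2)

/-- `C_m = 1 - √((m - 1) / m)` (used for `m ≥ 1`). -/
noncomputable def constC (m : ℕ) : ℝ := 1 - Real.sqrt (((m : ℝ) - 1) / m)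

/-- `ℓ(m) = (m + 1) 2^{m-1} - m² + m` (used for `m ≥ 1`; see `ell_cast`). -/
def ell (m : ℕ) : ℕ := (m + 1) * 2 ^ (m - 1) - m * (m - 1)

/-- `modF m y t` is the polynomial
`F_{m+1} = (y_1 ⋯ y_{m+1})^{2^m} P_{m+1}(y_1, …, y_m, 1 / (y_1 ⋯ y_{m+1}), t)`
with denominators cleared: since `P_{m+1}` is homogeneous of degree `2^m`,
it is `P_{m+1}(π y_1, …, π y_m, 1, π t)` with `π = y_1 ⋯ y_{m+1}`; see `modF_eq`. -/
def modF {R : Type*} [CommRing R] (m : ℕ) (y : Fin (m + 1) → R) (t : R) : R :=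
  peckerP m (Fin.snoc (α := fun _ => R) (fun i : Fin m => (∏ j, y j) * y i.castSucc) 1)
    ((∏ j, y j) * t)

/-- The modified Pecker polynomial
`Q_{m+1}(y_1, …, y_{m+1}, t) = (t / C_{m+1} + y_{m+1})^{ℓ(m+1)} F_{m+1}(y_1, …, y_{m+1}, t)`. -/
noncomputable def modQ (m : ℕ) (y : Fin (m + 1) → ℝ) (t : ℝ) : ℝ :=
  (t / constC (m + 1) + y (Fin.last m)) ^ ell (m + 1) * modF m y t

/-- A tuple `(g_1, …, g_{m+1})` in `ℝ[x']` is admissible if `m ≥ 1` and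
`g_{m+1} > 1` on `ℝ^{n-1}`. -/
def IsAdmissible {d m : ℕ} (g : Fin (m + 1) → MvPolynomial (Fin d) ℝ) : Prop :=
  1 ≤ m ∧ ∀ x' : Fin d → ℝ, 1 < MvPolynomial.eval x' (g (Fin.last m))

/-- The polynomial
`Q_g(x', x_n) = g_{m+1}^{ℓ₀} Q_{m+1}(g_1, …, g_m, 1, x_n² C_{m+1} / g_{m+1}²)`, where
`ℓ₀ = 2 ℓ(m+1) + 2^{m+1}`, with denominators cleared: writing `G = g_{m+1}`, `π = g_1 ⋯ g_m`, it is
`(x_n² + G²)^{ℓ(m+1)} P_{m+1}(G² π g_1, …, G² π g_m, G², π C_{m+1} x_n²)`; see `eval_polyQ`. -/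
noncomputable def polyQ {d m : ℕ} (g : Fin (m + 1) → MvPolynomial (Fin d) ℝ) :
    MvPolynomial (Fin (d + 1)) ℝ :=
  let γ : Fin (m + 1) → MvPolynomial (Fin (d + 1)) ℝ :=
    fun i => MvPolynomial.rename Fin.castSucc (g i)
  let G := γ (Fin.last m)
  let π := ∏ i : Fin m, γ i.castSucc
  let xn : MvPolynomial (Fin (d + 1)) ℝ := MvPolynomial.X (Fin.last d)
  (xn ^ 2 + G ^ 2) ^ ell (m + 1) *
    peckerP m
      (Fin.snoc (α := fun _ => MvPolynomial (Fin (d + 1)) ℝ)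
        (fun i : Fin m => G ^ 2 * π * γ i.castSucc) (G ^ 2))
      (π * MvPolynomial.C (constC (m + 1)) * xn ^ 2)

/-! ### Cylinders, the sets `A_g` and `S_g`, and the map `f` -/

/-- The vector `e_n`. -/
def eN (d : ℕ) : Fin (d + 1) → ℝ := Pi.single (Fin.last d) 1

/-- The cylinder `{x + λ v : x ∈ X, λ ∈ ℝ}`. -/
def cyl {d : ℕ} (X : Set (Fin (d + 1) → ℝ)) (v : Fin (d + 1) → ℝ) : Set (Fin (d + 1) → ℝ) :=
  {z | ∃ x ∈ X, ∃ c : ℝ, z = x + c • v}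

/-- The positive cylinder `{x + λ v : x ∈ X, λ ≥ 0}`. -/
def posCyl {d : ℕ} (X : Set (Fin (d + 1) → ℝ)) (v : Fin (d + 1) → ℝ) : Set (Fin (d + 1) → ℝ) :=
  {z | ∃ x ∈ X, ∃ c : ℝ, 0 ≤ c ∧ z = x + c • v}

/-- `A_g = {g_1 > 0, …, g_m > 0, x_n = 0}`. -/
def setA {d m : ℕ} (g : Fin (m + 1) → MvPolynomial (Fin d) ℝ) : Set (Fin (d + 1) → ℝ) :=
  {x | (∀ i : Fin m, 0 < MvPolynomial.eval (Fin.init x) (g i.castSucc)) ∧ x (Fin.last d) = 0}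

/-- `S_g`, the positive cylinder in the direction `e_n` of `{Q_g ≤ 0, x_n > 0}`. -/
def setS {d m : ℕ} (g : Fin (m + 1) → MvPolynomial (Fin d) ℝ) : Set (Fin (d + 1) → ℝ) :=
  posCyl {x | MvPolynomial.eval x (polyQ g) ≤ 0 ∧ 0 < x (Fin.last d)} (eN d)

/-- The last component `f_n(x) = x_n (1 + P(x) Q_g(x))² + h(x') (P(x) Q_g(x))²`. -/
noncomputable def mapLast {d m : ℕ} (g : Fin (m + 1) → MvPolynomial (Fin d) ℝ)
    (h : MvPolynomial (Fin d) ℝ) (P : MvPolynomial (Fin (d + 1)) ℝ) (x : Fin (d + 1) → ℝ) : ℝ :=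
  x (Fin.last d) * (1 + MvPolynomial.eval x P * MvPolynomial.eval x (polyQ g)) ^ 2 +
    MvPolynomial.eval (Fin.init x) h *
      (MvPolynomial.eval x P * MvPolynomial.eval x (polyQ g)) ^ 2

/-- The map `f(x', x_n) = (x', f_n(x', x_n))`. -/
noncomputable def mapF {d m : ℕ} (g : Fin (m + 1) → MvPolynomial (Fin d) ℝ)
    (h : MvPolynomial (Fin d) ℝ) (P : MvPolynomial (Fin (d + 1)) ℝ) (x : Fin (d + 1) → ℝ) :
    Fin (d + 1) → ℝ :=
  Fin.snoc (α := fun _ => ℝ) (Fin.init x) (mapLast g h P x)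

/-! ### The cleared denominators agree with the displayed formulas -/

theorem ell_cast (m : ℕ) (hm : 1 ≤ m) :
    (ell m : ℤ) = ((m : ℤ) + 1) * 2 ^ (m - 1) - (m : ℤ) ^ 2 + m := by
  obtain ⟨k, rfl⟩ : ∃ k, m = k + 1 := ⟨m - 1, by omega⟩
  have h2 : k < 2 ^ k := Nat.lt_two_pow_self
  have h3 : (k + 1) * (k + 1 - 1) ≤ (k + 1 + 1) * 2 ^ (k + 1 - 1) := by
    simp only [Nat.add_sub_cancel]
    exact Nat.mul_le_mul (by omega) h2.le
  unfold ell
  rw [Nat.cast_sub h3]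
  simp only [Nat.add_sub_cancel]
  push_cast
  ring

theorem peckerP_smul {R : Type*} [CommRing R] (m : ℕ) (c : R) (y : Fin (m + 1) → R) (t : R) :
    peckerP m (fun i => c * y i) (c * t) = c ^ 2 ^ m * peckerP m y t := by
  induction m generalizing c t with
  | zero => simp only [peckerP]; ring
  | succ m ih =>
    have h1 : auxA (fun i => c * y i) = fun k => c ^ 2 * auxA y k := by
      funext k
      simp only [auxA, ← Finset.mul_sum]
      ring
    have h2 : (c * t - ∑ i, c * y i) ^ 2 = c ^ 2 * (t - ∑ i, y i) ^ 2 := by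
      rw [← Finset.mul_sum]; ring
    simp only [peckerP]
    rw [h1, h2, ih, ← pow_mul]
    congr 2
    ring

theorem map_peckerP {R S : Type*} [CommRing R] [CommRing S] (φ : R →+* S) (m : ℕ)
    (y : Fin (m + 1) → R) (t : R) :
    φ (peckerP m y t) = peckerP m (fun i => φ (y i)) (φ t) := by
  induction m generalizing t with
  | zero => simp [peckerP]
  | succ m ih =>
    have h1 : auxA (fun i => φ (y i)) = fun k => φ (auxA y k) := by
      funext k
      simp [auxA, map_sum]
    simp only [peckerP]
    rw [h1, ih]
    simp [map_sum]

theorem modF_eq (m : ℕ) (y : Fin (m + 1) → ℝ) (hy : ∀ i, y i ≠ 0) (t : ℝ) :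
    modF m y t = (∏ j, y j) ^ 2 ^ m *
      peckerP m (Fin.snoc (α := fun _ => ℝ) (fun i : Fin m => y i.castSucc) (1 / ∏ j, y j)) t := by
  have hp : (∏ j, y j) ≠ 0 := Finset.prod_ne_zero_iff.mpr fun i _ => hy i
  rw [← peckerP_smul, modF]
  congr 1
  funext i
  refine Fin.lastCases ?_ (fun i => ?_) i
  · simp [hp]
  · simp

theorem eval_polyQ {d m : ℕ} (g : Fin (m + 1) → MvPolynomial (Fin d) ℝ) (x : Fin (d + 1) → ℝ)
    (hG : MvPolynomial.eval (Fin.init x) (g (Fin.last m)) ≠ 0) :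
    MvPolynomial.eval x (polyQ g) =
      MvPolynomial.eval (Fin.init x) (g (Fin.last m)) ^ (2 * ell (m + 1) + 2 ^ (m + 1)) *
        modQ m
          (Fin.snoc (α := fun _ => ℝ)
            (fun i : Fin m => MvPolynomial.eval (Fin.init x) (g i.castSucc)) 1)
          (x (Fin.last d) ^ 2 * constC (m + 1) /
            MvPolynomial.eval (Fin.init x) (g (Fin.last m)) ^ 2) := by
  have hC : constC (m + 1) ≠ 0 := by
    have h1 : Real.sqrt ((((m + 1 : ℕ) : ℝ) - 1) / (m + 1 : ℕ)) < 1 := by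
      rw [Real.sqrt_lt' one_pos, div_lt_iff₀ (by positivity)]
      linarith
    unfold constC
    linarith
  have hr : ∀ p : MvPolynomial (Fin d) ℝ,
      MvPolynomial.eval x (MvPolynomial.rename Fin.castSucc p) =
        MvPolynomial.eval (Fin.init x) p := by
    intro p
    rw [MvPolynomial.eval_rename]
    rfl
  have hpow : ∀ G : ℝ, G ^ (2 * ell (m + 1) + 2 ^ (m + 1)) =
      (G ^ 2) ^ ell (m + 1) * (G ^ 2) ^ 2 ^ m := by
    intro G
    rw [pow_add, pow_mul, ← pow_mul G 2 (2 ^ m), pow_succ' 2 m]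
  unfold polyQ modQ modF
  rw [map_mul, map_peckerP, hpow, mul_mul_mul_comm, ← peckerP_smul, ← mul_pow]
  congr 1
  · simp only [map_pow, map_add, MvPolynomial.eval_X, hr, Fin.snoc_last]
    congr 1
    field_simp
  · congr 1
    · funext i
      refine Fin.lastCases ?_ (fun i => ?_) i
      · simp [hr]
      · simp [hr, Fin.prod_univ_castSucc, mul_assoc]
    · simp only [map_mul, map_pow, map_prod, MvPolynomial.eval_X, MvPolynomial.eval_C, hr,
        Fin.prod_univ_castSucc, Fin.snoc_last, Fin.snoc_castSucc, mul_one]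
      field_simp

end Pecker

/-!
Everything happens on one vertical line. Over `x'`, write `y = (g_1(x'), …, g_m(x'))`,
`G = g_{m+1}(x')` and `z = (y, 1 / (y_1 ⋯ y_m))`, a tuple with product `1`. Up to positive factors
`Q_g(x', s)` is `P_{m+1}(z, t)` with `t = C_{m+1} s² / G²`. Two properties of Pecker's polynomials
locate its zeros: a value `P_{m+1}(z, t) ≤ 0` at some `t ≥ 0` forces `z ≥ 0`, and for `z ≥ 0` it
forces `C_{m+1} ∑ z_i ≤ t ≤ 2 ∑ z_i`. Since `∏ z_i = 1` gives `∑ z_i ≥ 1`, the lower bound reads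
`G ≤ s`. Conversely, if `y > 0`, unfolding the recursion produces a `t ≥ ∑ z_i` at which
`P_{m+1}(z, t)` is negative, and the factor with exponent `ℓ(m+1)` amplifies that value to at
most `-1`. So `P Q_g` passes continuously from a value `≤ -1` to positive values along the part
of the line in `S_g`. Where it equals `-1` the last coordinate of `f` is `h(x')`, and since that
coordinate tends to `+∞`, it takes every value `≥ h(x')`.
-/

namespace Pecker

open Filter MvPolynomial Set

/-- `snocℝ x s` is the real tuple `(x, s)`, the point at height `s` over `x`. -/
local notation "snocℝ" => Fin.snoc (α := fun _ => ℝ)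

/-! ### Sign of Pecker's polynomials -/

section OrderedRing

theorem auxA_castSucc {R : Type*} [CommRing R] {m : ℕ} (y : Fin (m + 3) → R) (k : Fin (m + 1)) :
    auxA y k.castSucc = auxA (fun i : Fin (m + 2) => y i.castSucc) k := by
  rw [auxA, auxA, Fin.sum_Iic_castSucc, Fin.succ_castSucc]

theorem auxA_last {R : Type*} [CommRing R] {m : ℕ} (y : Fin (m + 2) → R) :
    auxA y (Fin.last m) = y (Fin.last (m + 1)) * ∑ i : Fin (m + 1), y i.castSucc := by
  rw [auxA, Fin.sum_Iic_castSucc, Fin.succ_last, ← Fin.top_eq_last m, Finset.Iic_top]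

theorem two_mul_sum_auxA {R : Type*} [CommRing R] {m : ℕ} (y : Fin (m + 2) → R) :
    2 * ∑ k, auxA y k = (∑ i, y i) ^ 2 - ∑ i, y i ^ 2 := by
  induction m with
  | zero =>
    have ha : auxA y 0 = y 1 * y 0 := by simpa using auxA_last y
    rw [Fin.sum_univ_one, ha, Fin.sum_univ_two, Fin.sum_univ_two]
    ring
  | succ m ih =>
    rw [Fin.sum_univ_castSucc, auxA_last, Fin.sum_univ_castSucc (n := m + 2),
      Fin.sum_univ_castSucc (n := m + 2), mul_add]
    simp only [auxA_castSucc]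
    rw [ih]
    ring

variable {R : Type*} [CommRing R] [LinearOrder R] [IsStrictOrderedRing R]

theorem auxA_nonneg {m : ℕ} {y : Fin (m + 2) → R} (hy : ∀ i, 0 ≤ y i) (k : Fin (m + 1)) :
    0 ≤ auxA y k :=
  mul_nonneg (hy _) (Finset.sum_nonneg fun i _ => hy i)

theorem nonneg_or_nonpos_of_castSucc {n : ℕ} {y : Fin (n + 1) → R}
    (hinit : (∀ i : Fin n, 0 ≤ y i.castSucc) ∨ ∀ i : Fin n, y i.castSucc ≤ 0)
    (hlast : 0 ≤ y (Fin.last n) * ∑ i : Fin n, y i.castSucc) :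
    (∀ i, 0 ≤ y i) ∨ ∀ i, y i ≤ 0 := by
  rcases hinit with hinit | hinit
  · rcases le_or_gt 0 (y (Fin.last n)) with hl | hl
    · exact Or.inl (Fin.lastCases hl hinit)
    · have hsum := nonpos_of_mul_nonneg_right hlast hl
      exact Or.inr (Fin.lastCases hl.le fun i =>
        (Finset.single_le_sum (fun j _ => hinit j) (Finset.mem_univ i)).trans hsum)
  · rcases le_or_gt (y (Fin.last n)) 0 with hl | hl
    · exact Or.inr (Fin.lastCases hl hinit)
    · have hsum : ∑ i : Fin n, y i.castSucc = 0 :=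
        (Finset.sum_nonpos fun j _ => hinit j).antisymm (nonneg_of_mul_nonneg_right hlast hl)
      have hzero := (Finset.sum_eq_zero_iff_of_nonpos fun j _ => hinit j).1 hsum
      exact Or.inl (Fin.lastCases hl.le fun i => (hzero i (Finset.mem_univ i)).ge)

theorem nonneg_or_nonpos_of_auxA_nonneg {m : ℕ} {y : Fin (m + 2) → R} (h : ∀ k, 0 ≤ auxA y k) :
    (∀ i, 0 ≤ y i) ∨ ∀ i, y i ≤ 0 := by
  have hlast := auxA_last y ▸ h (Fin.last m)
  induction m with
  | zero =>
    refine nonneg_or_nonpos_of_castSucc ?_ hlast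
    simpa using le_total 0 (y 0)
  | succ m ih =>
    have hinit : ∀ k, 0 ≤ auxA (fun i : Fin (m + 2) => y i.castSucc) k :=
      fun k => auxA_castSucc y k ▸ h k.castSucc
    have hlast' := auxA_last (fun i : Fin (m + 2) => y i.castSucc) ▸ hinit (Fin.last m)
    exact nonneg_or_nonpos_of_castSucc (ih hinit hlast') hlast

theorem peckerP_pos_of_two_mul_sum_le {m : ℕ} {y : Fin (m + 1) → R} {t : R} (hy : ∀ i, 0 ≤ y i)
    (ht : 0 < t) (hsum : 2 * ∑ i, y i ≤ t) : 0 < peckerP m y t := by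
  induction m generalizing t with
  | zero =>
    rw [Fin.sum_univ_one] at hsum
    rw [peckerP]
    linarith [hy 0]
  | succ m ih =>
    have hS : 0 ≤ ∑ i, y i := Finset.sum_nonneg fun i _ => hy i
    have hsq : 0 ≤ ∑ i, y i ^ 2 := Finset.sum_nonneg fun i _ => sq_nonneg _
    refine ih (auxA_nonneg hy) (pow_pos (by linarith) 2) ?_
    calc 2 * ∑ k, auxA y k = (∑ i, y i) ^ 2 - ∑ i, y i ^ 2 := two_mul_sum_auxA y
      _ ≤ (∑ i, y i) ^ 2 := sub_le_self _ hsq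
      _ ≤ (t - ∑ i, y i) ^ 2 := pow_le_pow_left₀ hS (by linarith) 2

theorem nonneg_of_peckerP_nonpos {m : ℕ} {y : Fin (m + 1) → R} {t : R} (ht : 0 ≤ t)
    (h : peckerP m y t ≤ 0) (i : Fin (m + 1)) : 0 ≤ y i := by
  induction m generalizing t with
  | zero =>
    rw [peckerP, sub_nonpos] at h
    rw [Fin.fin_one_eq_zero i]
    exact ht.trans h
  | succ m ih =>
    have ha : ∀ k, 0 ≤ auxA y k := ih (sq_nonneg _) h
    rcases nonneg_or_nonpos_of_auxA_nonneg ha with hy | hy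
    · exact hy i
    · by_contra! hi
      have hS : ∑ i, y i < 0 := Finset.sum_neg' (fun i _ => hy i) ⟨i, Finset.mem_univ i, hi⟩
      have hsq : 0 ≤ ∑ i, y i ^ 2 := Finset.sum_nonneg fun i _ => sq_nonneg _
      refine h.not_gt (peckerP_pos_of_two_mul_sum_le (m := m) ha (pow_pos (by linarith) 2) ?_)
      calc 2 * ∑ k, auxA y k = (∑ i, y i) ^ 2 - ∑ i, y i ^ 2 := two_mul_sum_auxA y
        _ ≤ (-∑ i, y i) ^ 2 := by rw [neg_sq]; exact sub_le_self _ hsq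
        _ ≤ (t - ∑ i, y i) ^ 2 := pow_le_pow_left₀ (by linarith) (by linarith) 2

theorem peckerP_succ_pos_of_mul_sq_sum_lt {m : ℕ} {y : Fin (m + 2) → R} {t : R}
    (hy : ∀ i, 0 ≤ y i)
    (ht : (m + 1) * (∑ i, y i) ^ 2 < (m + 2) * (t - ∑ i, y i) ^ 2) : 0 < peckerP (m + 1) y t := by
  have hm : (0 : R) < m + 2 := by positivity
  have hcs : (∑ i, y i) ^ 2 ≤ (m + 2) * ∑ i, y i ^ 2 := by
    simpa [add_assoc, one_add_one_eq_two] using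
      sq_sum_le_card_mul_sum_sq (s := Finset.univ) (f := y)
  refine peckerP_pos_of_two_mul_sum_le (m := m) (auxA_nonneg hy) ?_ ?_
  · exact pos_of_mul_pos_right (lt_of_le_of_lt (by positivity) ht) hm.le
  · refine le_of_mul_le_mul_left ?_ hm
    rw [two_mul_sum_auxA]
    linarith

theorem sq_le_auxA {m : ℕ} {y : Fin (m + 2) → R} {δ : R} (hδ : 0 ≤ δ) (hy : ∀ i, δ ≤ y i)
    (k : Fin (m + 1)) : δ ^ 2 ≤ auxA y k := by
  rw [sq]
  have hsum : y k.castSucc ≤ ∑ i ∈ Finset.Iic k.castSucc, y i :=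
    Finset.single_le_sum (fun i _ => hδ.trans (hy i)) (Finset.mem_Iic.2 le_rfl)
  exact mul_le_mul (hy _) ((hy _).trans hsum) hδ (hδ.trans (hy _))

theorem prod_mul_pow_le_prod_auxA {m : ℕ} {y : Fin (m + 2) → R} {δ : R} (hδ : 0 ≤ δ)
    (hy : ∀ i, δ ≤ y i) : (∏ i, y i) * δ ^ m ≤ ∏ k, auxA y k := by
  have hy0 : ∀ i, 0 ≤ y i := fun i => hδ.trans (hy i)
  have hsum (k : Fin m) : δ ≤ ∑ i ∈ Finset.Iic k.succ.castSucc, y i :=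
    (hy k.succ.castSucc).trans
      (Finset.single_le_sum (fun i _ => hy0 i) (Finset.mem_Iic.2 le_rfl))
  have hzero : ∑ i ∈ Finset.Iic (Fin.castSucc (0 : Fin (m + 1))), y i = y 0 := by
    rw [Fin.castSucc_zero, ← bot_eq_zero, Finset.Iic_bot, Finset.sum_singleton]
  calc (∏ i, y i) * δ ^ m
      = (∏ k : Fin (m + 1), y k.succ) * (y 0 * ∏ _k : Fin m, δ) := by
        rw [Fin.prod_univ_succ, Fin.prod_const]
        ring
    _ ≤ (∏ k : Fin (m + 1), y k.succ) *
          (y 0 * ∏ k : Fin m, ∑ i ∈ Finset.Iic k.succ.castSucc, y i) :=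
        mul_le_mul_of_nonneg_left
          (mul_le_mul_of_nonneg_left
            (Finset.prod_le_prod (fun _ _ => hδ) fun k _ => hsum k) (hy0 0))
          (Finset.prod_nonneg fun k _ => hy0 _)
    _ = ∏ k, auxA y k := by
        simp only [auxA]
        rw [Finset.prod_mul_distrib, Fin.prod_univ_succ (fun k => ∑ i ∈ Finset.Iic _, y i), hzero]

theorem one_le_sum_of_prod_eq_one {ι : Type*} [Fintype ι] [Nonempty ι] {y : ι → R}
    (hy : ∀ i, 0 ≤ y i) (h : ∏ i, y i = 1) : 1 ≤ ∑ i, y i := by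
  by_contra! hS
  have hlt : (∑ i, y i) ^ Fintype.card ι < 1 :=
    pow_lt_one₀ (Finset.sum_nonneg fun i _ => hy i) hS Fintype.card_ne_zero
  refine hlt.not_ge ?_
  calc (1 : R) = ∏ i, y i := h.symm
    _ ≤ ∏ _i : ι, ∑ j, y j := Finset.prod_le_prod (fun i _ => hy i) fun i hi =>
        Finset.single_le_sum (fun j _ => hy j) hi
    _ = (∑ i, y i) ^ Fintype.card ι := by rw [Finset.prod_const, Finset.card_univ]

theorem one_le_mul_sum_pow_of_prod_eq_one {n : ℕ} {y : Fin (n + 1) → R} (hy : ∀ i, 0 ≤ y i)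
    (h : ∏ i, y i = 1) (i : Fin (n + 1)) : 1 ≤ y i * (∑ j, y j) ^ n :=
  calc (1 : R) = y i * ∏ j : Fin n, y (i.succAbove j) := by rw [← h, Fin.prod_univ_succAbove _ i]
    _ ≤ y i * ∏ _j : Fin n, ∑ j, y j :=
        mul_le_mul_of_nonneg_left
          (Finset.prod_le_prod (fun j _ => hy _) fun j _ =>
            Finset.single_le_sum (fun j _ => hy j) (Finset.mem_univ _)) (hy i)
    _ = y i * (∑ j, y j) ^ n := by rw [Fin.prod_const]

end OrderedRing

section Real

variable {m : ℕ}

theorem one_sub_constC_nonneg (m : ℕ) : 0 ≤ 1 - constC m := by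
  rw [constC, sub_sub_cancel]
  exact Real.sqrt_nonneg _

theorem mul_one_sub_constC_sq (m : ℕ) : (m + 1) * (1 - constC (m + 1)) ^ 2 = m := by
  rw [constC, sub_sub_cancel, Nat.cast_succ, add_sub_cancel_right, Real.sq_sqrt (by positivity)]
  field_simp

theorem constC_succ_pos (m : ℕ) : 0 < constC (m + 1) := by
  have hsq := mul_one_sub_constC_sq m
  by_contra! hC
  nlinarith [sq_nonneg (constC (m + 1))]

theorem peckerP_pos_of_lt_constC_mul_sum (hm : 1 ≤ m) {y : Fin (m + 1) → ℝ} {t : ℝ}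
    (hy : ∀ i, 0 ≤ y i) (ht : t < constC (m + 1) * ∑ i, y i) : 0 < peckerP m y t := by
  obtain ⟨m, rfl⟩ := Nat.exists_eq_add_of_le' hm
  have hS : 0 ≤ ∑ i, y i := Finset.sum_nonneg fun i _ => hy i
  have hC := mul_one_sub_constC_sq (m + 1)
  push_cast at hC
  have hlt : ((1 - constC (m + 2)) * ∑ i, y i) ^ 2 < (∑ i, y i - t) ^ 2 :=
    pow_lt_pow_left₀ (by linarith) (mul_nonneg (one_sub_constC_nonneg _) hS) two_ne_zero
  refine peckerP_succ_pos_of_mul_sq_sum_lt hy ?_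
  calc (m + 1) * (∑ i, y i) ^ 2 = (m + 2) * ((1 - constC (m + 2)) * ∑ i, y i) ^ 2 := by
        rw [← hC]
        ring
    _ < (m + 2) * (∑ i, y i - t) ^ 2 := by gcongr
    _ = (m + 2) * (t - ∑ i, y i) ^ 2 := by ring

/-! ### Negative values of Pecker's polynomials -/

theorem exists_peckerP_le {δ : ℝ} (hm : 1 ≤ m) {y : Fin (m + 1) → ℝ} (hδ : 0 ≤ δ)
    (hy : ∀ i, δ ≤ y i) :
    ∃ t, ∑ i, y i ≤ t ∧ peckerP m y t ≤ -((∏ i, y i) * δ ^ (2 ^ m - (m + 1))) := by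
  induction m, hm using Nat.le_induction generalizing δ with
  | base =>
    have ha : auxA y 0 = y 1 * y 0 := by simpa using auxA_last y
    refine ⟨∑ i, y i, le_rfl, le_of_eq ?_⟩
    rw [peckerP, peckerP, ha, Fin.prod_univ_two]
    ring
  | succ m hm ih =>
    obtain ⟨t, hsum, ht⟩ := ih (sq_nonneg δ) (sq_le_auxA hδ hy)
    have ht0 : 0 ≤ t :=
      (Finset.sum_nonneg fun k _ => auxA_nonneg (fun i => hδ.trans (hy i)) k).trans hsum
    have hexp : 2 ^ (m + 1) - (m + 2) = m + 2 * (2 ^ m - (m + 1)) := by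
      have := Nat.lt_two_pow_self (n := m)
      omega
    refine ⟨∑ i, y i + √t, le_add_of_nonneg_right (Real.sqrt_nonneg t), ?_⟩
    calc peckerP (m + 1) y (∑ i, y i + √t) = peckerP m (auxA y) t := by
          rw [peckerP, add_sub_cancel_left, Real.sq_sqrt ht0]
      _ ≤ -((∏ k, auxA y k) * (δ ^ 2) ^ (2 ^ m - (m + 1))) := ht
      _ ≤ -((∏ i, y i) * δ ^ m * (δ ^ 2) ^ (2 ^ m - (m + 1))) := by
          gcongr
          exact prod_mul_pow_le_prod_auxA hδ hy
      _ = -((∏ i, y i) * δ ^ (2 ^ (m + 1) - (m + 2))) := by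
          rw [hexp, pow_add, pow_mul, mul_assoc]

theorem exists_peckerP_le_of_prod_eq_one (hm : 1 ≤ m) {y : Fin (m + 1) → ℝ} (hy : ∀ i, 0 ≤ y i)
    (h : ∏ i, y i = 1) :
    ∃ t, ∑ i, y i ≤ t ∧ peckerP m y t ≤ -((∑ i, y i) ^ (m * (2 ^ m - (m + 1))))⁻¹ := by
  have hS : 0 < ∑ i, y i := one_pos.trans_le (one_le_sum_of_prod_eq_one hy h)
  have hle (i : Fin (m + 1)) : ((∑ j, y j) ^ m)⁻¹ ≤ y i :=
    (inv_le_iff_one_le_mul₀ (pow_pos hS m)).2 (one_le_mul_sum_pow_of_prod_eq_one hy h i)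
  obtain ⟨t, hsum, ht⟩ := exists_peckerP_le hm (by positivity) hle
  refine ⟨t, hsum, ht.trans_eq ?_⟩
  rw [h, one_mul, inv_pow, pow_mul]

/-! ### The modified polynomials at `y_{m+1} = 1` -/

/-- The point `(y_1, …, y_m, 1 / (y_1 ⋯ y_m))` at which `F_{m+1}(y_1, …, y_m, 1, t)` evaluates
`P_{m+1}`. -/
noncomputable def snocInvProd (y : Fin m → ℝ) : Fin (m + 1) → ℝ :=
  snocℝ y (∏ i, y i)⁻¹

theorem prod_snocInvProd {y : Fin m → ℝ} (hy : ∀ i, y i ≠ 0) : ∏ i, snocInvProd y i = 1 := by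
  rw [snocInvProd, Fin.prod_snoc]
  exact mul_inv_cancel₀ (Finset.prod_ne_zero_iff.2 fun i _ => hy i)

theorem snocInvProd_nonneg {y : Fin m → ℝ} (hy : ∀ i, 0 ≤ y i) (i : Fin (m + 1)) :
    0 ≤ snocInvProd y i := by
  refine Fin.lastCases ?_ (fun j => ?_) i
  · simpa [snocInvProd] using Finset.prod_nonneg fun i _ => hy i
  · simpa [snocInvProd] using hy j

theorem one_le_sum_snocInvProd {y : Fin m → ℝ} (hy : ∀ i, 0 < y i) :
    1 ≤ ∑ i, snocInvProd y i :=
  one_le_sum_of_prod_eq_one (snocInvProd_nonneg fun i => (hy i).le)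
    (prod_snocInvProd fun i => (hy i).ne')

theorem one_le_sum_snocInvProd_mul_prod {y : Fin m → ℝ} (hy : ∀ i, 0 < y i) :
    1 ≤ (∑ i, snocInvProd y i) * ∏ i, y i := by
  have hlast : (∏ i, y i)⁻¹ ≤ ∑ i, snocInvProd y i := by
    simpa [snocInvProd] using Finset.single_le_sum
      (fun i _ => snocInvProd_nonneg (fun i => (hy i).le) i) (Finset.mem_univ (Fin.last m))
  exact (inv_le_iff_one_le_mul₀ (Finset.prod_pos fun i _ => hy i)).1 hlast

theorem modF_snoc_one {y : Fin m → ℝ} (hy : ∀ i, y i ≠ 0) (t : ℝ) :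
    modF m (snocℝ y 1) t = (∏ i, y i) ^ 2 ^ m * peckerP m (snocInvProd y) t := by
  rw [modF_eq _ _ (Fin.lastCases (by simp) fun j => by simpa using hy j)]
  simp [Fin.prod_snoc, snocInvProd]

theorem peckerP_snocInvProd_nonpos (hm : 1 ≤ m) {y : Fin m → ℝ} {t : ℝ} (hy : ∀ i, y i ≠ 0)
    (h : modF m (snocℝ y 1) t ≤ 0) : peckerP m (snocInvProd y) t ≤ 0 := by
  rw [modF_snoc_one hy] at h
  refine nonpos_of_mul_nonpos_right h ?_
  exact (even_two.pow_of_ne_zero (by omega)).pow_pos (Finset.prod_ne_zero_iff.2 fun i _ => hy i)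

theorem modF_snoc_one_pos_of_eq_zero (hm : 1 ≤ m) {y : Fin m → ℝ} {j : Fin m} (hj : y j = 0)
    (t : ℝ) : 0 < modF m (snocℝ y 1) t := by
  have hprod : ∏ i, snocℝ y 1 i = 0 :=
    Finset.prod_eq_zero (Finset.mem_univ j.castSucc) (by simpa using hj)
  rw [modF, hprod]
  refine peckerP_pos_of_lt_constC_mul_sum hm (Fin.lastCases (by simp) fun k => by simp) ?_
  simpa [Fin.sum_snoc] using constC_succ_pos m

theorem pos_of_modF_snoc_one_nonpos (hm : 1 ≤ m) {y : Fin m → ℝ} {t : ℝ} (ht : 0 ≤ t)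
    (h : modF m (snocℝ y 1) t ≤ 0) (i : Fin m) : 0 < y i := by
  have hy (j : Fin m) : y j ≠ 0 := fun hj => h.not_gt (modF_snoc_one_pos_of_eq_zero hm hj t)
  have hi := nonneg_of_peckerP_nonpos ht (peckerP_snocInvProd_nonpos hm hy h) i.castSucc
  rw [snocInvProd, Fin.snoc_castSucc] at hi
  exact hi.lt_of_ne (hy i).symm

theorem constC_le_of_modF_snoc_one_nonpos (hm : 1 ≤ m) {y : Fin m → ℝ} {t : ℝ} (ht : 0 ≤ t)
    (h : modF m (snocℝ y 1) t ≤ 0) : constC (m + 1) ≤ t := by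
  have hy := pos_of_modF_snoc_one_nonpos hm ht h
  by_contra! hlt
  refine (peckerP_snocInvProd_nonpos hm (fun i => (hy i).ne') h).not_gt ?_
  refine peckerP_pos_of_lt_constC_mul_sum hm (snocInvProd_nonneg fun i => (hy i).le) ?_
  exact hlt.trans_le (le_mul_of_one_le_right (constC_succ_pos m).le (one_le_sum_snocInvProd hy))

theorem eventually_modF_snoc_one_pos (hm : 1 ≤ m) (y : Fin m → ℝ) :
    ∀ᶠ t in atTop, 0 < modF m (snocℝ y 1) t := by
  filter_upwards [eventually_gt_atTop 0, eventually_ge_atTop (2 * ∑ i, snocInvProd y i)]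
    with t ht hsum
  by_contra! h
  have hy := pos_of_modF_snoc_one_nonpos hm ht.le h
  exact (peckerP_snocInvProd_nonpos hm (fun i => (hy i).ne') h).not_gt
    (peckerP_pos_of_two_mul_sum_le (snocInvProd_nonneg fun i => (hy i).le) ht hsum)

theorem ell_succ (m : ℕ) : ell (m + 1) = m * (2 ^ m - (m + 1)) + 2 * 2 ^ m := by
  obtain ⟨r, hr⟩ := Nat.exists_eq_add_of_le (Nat.succ_le_of_lt (Nat.lt_two_pow_self (n := m)))
  rw [ell, Nat.add_sub_cancel, hr, Nat.succ_eq_add_one, Nat.add_sub_cancel_left]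
  refine Nat.sub_eq_of_eq_add ?_
  ring

theorem exists_modQ_snoc_one_le_neg_one (hm : 1 ≤ m) {y : Fin m → ℝ} (hy : ∀ i, 0 < y i) :
    ∃ t, 0 < t ∧ modQ m (snocℝ y 1) t ≤ -1 := by
  obtain ⟨t, hSt, hP⟩ := exists_peckerP_le_of_prod_eq_one hm
    (snocInvProd_nonneg fun i => (hy i).le) (prod_snocInvProd fun i => (hy i).ne')
  have hS := one_le_sum_snocInvProd hy
  have hSprod := one_le_sum_snocInvProd_mul_prod hy
  have hprod : 0 < ∏ i, y i := Finset.prod_pos fun i _ => hy i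
  set S := ∑ i, snocInvProd y i
  set N := 2 ^ m
  set E := m * (N - (m + 1))
  have hS0 : 0 < S := one_pos.trans_le hS
  have ht : 0 < t := hS0.trans_le hSt
  have hST : S ≤ t / constC (m + 1) + 1 := by
    have : t ≤ t / constC (m + 1) :=
      le_div_self ht.le (constC_succ_pos m) (sub_nonneg.1 (one_sub_constC_nonneg _))
    linarith
  have hfactor : S ^ E ≤ (t / constC (m + 1) + 1) ^ ell (m + 1) * (∏ i, y i) ^ N :=
    calc S ^ E ≤ S ^ E * (S ^ N * (S * ∏ i, y i) ^ N) :=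
          le_mul_of_one_le_right (by positivity)
            (one_le_mul_of_one_le_of_one_le (one_le_pow₀ hS) (one_le_pow₀ hSprod))
      _ = S ^ ell (m + 1) * (∏ i, y i) ^ N := by
          rw [ell_succ]
          ring
      _ ≤ _ := by gcongr
  refine ⟨t, ht, ?_⟩
  calc modQ m (snocℝ y 1) t
      = (t / constC (m + 1) + 1) ^ ell (m + 1) * (∏ i, y i) ^ N * peckerP m (snocInvProd y) t := by
        rw [modQ, Fin.snoc_last, modF_snoc_one fun i => (hy i).ne', mul_assoc]
    _ ≤ (t / constC (m + 1) + 1) ^ ell (m + 1) * (∏ i, y i) ^ N * -(S ^ E)⁻¹ :=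
        mul_le_mul_of_nonneg_left hP ((pow_pos hS0 E).le.trans hfactor)
    _ ≤ -1 := by
        rw [mul_neg, neg_le_neg_iff, ← div_eq_mul_inv]
        exact (one_le_div₀ (pow_pos hS0 E)).2 hfactor

/-! ### The polynomial `Q_g` on a vertical line -/

/-- `Q_g(x', s)` as a function of the height `s`, in terms of `y = (g_1(x'), …, g_m(x'))` and
`G = g_{m+1}(x')`. -/
noncomputable def fiberQ (y : Fin m → ℝ) (G s : ℝ) : ℝ :=
  G ^ (2 * ell (m + 1) + 2 ^ (m + 1)) * modQ m (snocℝ y 1) (s ^ 2 * constC (m + 1) / G ^ 2)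

theorem fiberQ_pos_iff {y : Fin m → ℝ} {G : ℝ} (hG : 0 < G) (s : ℝ) :
    0 < fiberQ y G s ↔ 0 < modF m (snocℝ y 1) (s ^ 2 * constC (m + 1) / G ^ 2) := by
  have hC := constC_succ_pos m
  rw [fiberQ, modQ, Fin.snoc_last, mul_pos_iff_of_pos_left (by positivity),
    mul_pos_iff_of_pos_left (by positivity)]

theorem fiberQ_nonpos_iff {y : Fin m → ℝ} {G : ℝ} (hG : 0 < G) (s : ℝ) :
    fiberQ y G s ≤ 0 ↔ modF m (snocℝ y 1) (s ^ 2 * constC (m + 1) / G ^ 2) ≤ 0 := by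
  simpa only [not_lt] using (fiberQ_pos_iff hG s).not

theorem pos_of_fiberQ_nonpos (hm : 1 ≤ m) {y : Fin m → ℝ} {G s : ℝ} (hG : 0 < G)
    (h : fiberQ y G s ≤ 0) (i : Fin m) : 0 < y i := by
  have hC := constC_succ_pos m
  exact pos_of_modF_snoc_one_nonpos hm (by positivity) ((fiberQ_nonpos_iff hG s).1 h) i

theorem le_of_fiberQ_nonpos (hm : 1 ≤ m) {y : Fin m → ℝ} {G s : ℝ} (hG : 0 < G) (hs : 0 ≤ s)
    (h : fiberQ y G s ≤ 0) : G ≤ s := by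
  have hC := constC_succ_pos m
  have hCle := constC_le_of_modF_snoc_one_nonpos hm (by positivity) ((fiberQ_nonpos_iff hG s).1 h)
  rw [le_div_iff₀ (by positivity), mul_comm] at hCle
  exact le_of_sq_le_sq (le_of_mul_le_mul_right hCle hC) hs

theorem eventually_fiberQ_pos (hm : 1 ≤ m) (y : Fin m → ℝ) {G : ℝ} (hG : 0 < G) :
    ∀ᶠ s in atTop, 0 < fiberQ y G s := by
  simp only [fiberQ_pos_iff hG]
  have htop : Tendsto (fun s : ℝ => s ^ 2 * constC (m + 1) / G ^ 2) atTop atTop :=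
    ((tendsto_pow_atTop two_ne_zero).atTop_mul_const (constC_succ_pos m)).atTop_div_const
      (by positivity)
  exact htop.eventually (eventually_modF_snoc_one_pos hm y)

theorem exists_fiberQ_le_neg_one (hm : 1 ≤ m) {y : Fin m → ℝ} {G : ℝ} (hG : 1 ≤ G)
    (hy : ∀ i, 0 < y i) : ∃ s, 0 < s ∧ fiberQ y G s ≤ -1 := by
  obtain ⟨t, ht, hQ⟩ := exists_modQ_snoc_one_le_neg_one hm hy
  have hG0 : 0 < G := one_pos.trans_le hG
  have hC := constC_succ_pos m
  have hsubst : √(t * G ^ 2 / constC (m + 1)) ^ 2 * constC (m + 1) / G ^ 2 = t := by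
    rw [Real.sq_sqrt (by positivity), div_mul_cancel₀ _ hC.ne',
      mul_div_cancel_right₀ _ (pow_pos hG0 2).ne']
  refine ⟨√(t * G ^ 2 / constC (m + 1)), by positivity, ?_⟩
  rw [fiberQ, hsubst]
  nlinarith [one_le_pow₀ hG (n := 2 * ell (m + 1) + 2 ^ (m + 1))]

/-! ### The last coordinate of `f` on a vertical line -/

/-- The last coordinate of `f` at height `s`, in terms of `h = h(x')` and `q = P(x) Q_g(x)`. -/
def stretch (h q s : ℝ) : ℝ := s * (1 + q) ^ 2 + h * q ^ 2

theorem stretch_neg_one (h s : ℝ) : stretch h (-1) s = h := by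
  simp [stretch]

theorem le_stretch {h q s : ℝ} (hh : 0 ≤ h) (hq : 0 ≤ q) (hs : 0 ≤ s) : s ≤ stretch h q s :=
  calc s ≤ s * (1 + q) ^ 2 := le_mul_of_one_le_right hs (one_le_pow₀ (by linarith))
    _ ≤ stretch h q s := le_add_of_nonneg_right (by positivity)

theorem le_two_mul_stretch {h q s : ℝ} (hh : 0 ≤ h) (hs : h ≤ s) : h ≤ 2 * stretch h q s :=
  calc h ≤ h + h * (2 * q + 1) ^ 2 := le_add_of_nonneg_right (by positivity)
    _ = 2 * stretch h q h := by
        rw [stretch]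
        ring
    _ ≤ 2 * stretch h q s := by
        unfold stretch
        gcongr

theorem tendsto_stretch {h : ℝ} {q : ℝ → ℝ} (hh : 0 ≤ h) (hq : ∀ᶠ s in atTop, 0 ≤ q s) :
    Tendsto (fun s => stretch h (q s) s) atTop atTop := by
  refine tendsto_atTop_mono' _ ?_ tendsto_id
  filter_upwards [hq, eventually_ge_atTop 0] with s hqs hs using le_stretch hh hqs hs

theorem Ici_subset_image_stretch {a h : ℝ} {q : ℝ → ℝ} (hh : 0 ≤ h)
    (hqc : ContinuousOn q (Ici a)) (hqa : q a ≤ -1) (hq : ∀ᶠ s in atTop, 0 ≤ q s) :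
    Ici h ⊆ (fun s => stretch h (q s) s) '' Ici a := by
  obtain ⟨b, hqb, hab⟩ := (hq.and (eventually_ge_atTop a)).exists
  obtain ⟨c, hc, hqc_eq⟩ : -1 ∈ q '' Icc a b :=
    intermediate_value_Icc hab (hqc.mono Icc_subset_Ici_self) ⟨hqa, by linarith⟩
  have hca : Ici c ⊆ Ici a := Ici_subset_Ici.2 hc.1
  have hcont : ContinuousOn (fun s => stretch h (q s) s) (Ici c) := by
    have := hqc.mono hca
    unfold stretch
    fun_prop
  calc Ici h = Ici (stretch h (q c) c) := by rw [hqc_eq, stretch_neg_one]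
    _ ⊆ (fun s => stretch h (q s) s) '' Ici c :=
        intermediate_value_Ici hcont (tendsto_stretch hh hq)
    _ ⊆ _ := image_mono hca

end Real

/-! ### The sets `A_g` and `S_g` and the map `f` -/

section Fibration

variable {d m : ℕ} {g : Fin (m + 1) → MvPolynomial (Fin d) ℝ}

theorem add_smul_eN (x : Fin (d + 1) → ℝ) (c : ℝ) :
    x + c • eN d = snocℝ (Fin.init x) (x (Fin.last d) + c) := by
  funext i
  refine Fin.lastCases ?_ (fun j => ?_) i
  · simp [eN]
  · simp [eN, Fin.init]

theorem mem_cyl_eN_iff {X : Set (Fin (d + 1) → ℝ)} {x : Fin (d + 1) → ℝ} :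
    x ∈ cyl X (eN d) ↔ ∃ s, snocℝ (Fin.init x) s ∈ X := by
  constructor
  · rintro ⟨x, hx, c, rfl⟩
    exact ⟨x (Fin.last d), by rwa [add_smul_eN, Fin.init_snoc, Fin.snoc_init_self]⟩
  · rintro ⟨s, hs⟩
    exact ⟨_, hs, x (Fin.last d) - s, by simp [add_smul_eN]⟩

theorem mem_posCyl_eN_iff {X : Set (Fin (d + 1) → ℝ)} {x : Fin (d + 1) → ℝ} :
    x ∈ posCyl X (eN d) ↔ ∃ s ≤ x (Fin.last d), snocℝ (Fin.init x) s ∈ X := by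
  constructor
  · rintro ⟨x, hx, c, hc, rfl⟩
    refine ⟨x (Fin.last d), ?_, by rwa [add_smul_eN, Fin.init_snoc, Fin.snoc_init_self]⟩
    rw [add_smul_eN, Fin.snoc_last]
    exact le_add_of_nonneg_right hc
  · rintro ⟨s, hsx, hs⟩
    exact ⟨_, hs, x (Fin.last d) - s, sub_nonneg.2 hsx, by simp [add_smul_eN]⟩

/-- The tuple `(g_1(x'), …, g_m(x'))`, without the last member `g_{m+1}`. -/
noncomputable def evalInit (g : Fin (m + 1) → MvPolynomial (Fin d) ℝ) (x' : Fin d → ℝ) :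
    Fin m → ℝ :=
  fun i => eval x' (g i.castSucc)

theorem snoc_mem_setA_iff {x' : Fin d → ℝ} {s : ℝ} :
    snocℝ x' s ∈ setA g ↔ (∀ i, 0 < evalInit g x' i) ∧ s = 0 := by
  simp [setA, evalInit]

theorem forall_mem_setA_iff (p : (Fin d → ℝ) → Prop) :
    (∀ x ∈ setA g, p (Fin.init x)) ↔ ∀ x', (∀ i, 0 < evalInit g x' i) → p x' := by
  refine ⟨fun hp x' hx' => ?_, fun hp x hx => hp _ hx.1⟩
  simpa using hp (snocℝ x' 0) (snoc_mem_setA_iff.2 ⟨hx', rfl⟩)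

theorem mem_cyl_setA_iff {x : Fin (d + 1) → ℝ} :
    x ∈ cyl (setA g) (eN d) ↔ ∀ i, 0 < evalInit g (Fin.init x) i := by
  simp [mem_cyl_eN_iff, snoc_mem_setA_iff]

theorem mem_posCyl_setA_iff {x : Fin (d + 1) → ℝ} :
    x ∈ posCyl (setA g) (eN d) ↔
      (∀ i, 0 < evalInit g (Fin.init x) i) ∧ 0 ≤ x (Fin.last d) := by
  simp [mem_posCyl_eN_iff, snoc_mem_setA_iff, and_comm]

theorem eval_polyQ_eq_fiberQ {x : Fin (d + 1) → ℝ}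
    (hG : eval (Fin.init x) (g (Fin.last m)) ≠ 0) :
    eval x (polyQ g) =
      fiberQ (evalInit g (Fin.init x)) (eval (Fin.init x) (g (Fin.last m))) (x (Fin.last d)) :=
  eval_polyQ g x hG

theorem eval_snoc_polyQ {x' : Fin d → ℝ} (hG : eval x' (g (Fin.last m)) ≠ 0) (s : ℝ) :
    eval (snocℝ x' s) (polyQ g) = fiberQ (evalInit g x') (eval x' (g (Fin.last m))) s := by
  rw [eval_polyQ_eq_fiberQ (by rwa [Fin.init_snoc]), Fin.init_snoc, Fin.snoc_last]

theorem mem_setS_iff {x : Fin (d + 1) → ℝ} (hG : eval (Fin.init x) (g (Fin.last m)) ≠ 0) :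
    x ∈ setS g ↔ ∃ s, 0 < s ∧ s ≤ x (Fin.last d) ∧
      fiberQ (evalInit g (Fin.init x)) (eval (Fin.init x) (g (Fin.last m))) s ≤ 0 := by
  rw [setS, mem_posCyl_eN_iff]
  simp only [mem_ofPred_eq, Fin.snoc_last, eval_snoc_polyQ hG]
  tauto

theorem evalInit_pos_of_mem_setS (hm : 1 ≤ m) {x : Fin (d + 1) → ℝ}
    (hG : 0 < eval (Fin.init x) (g (Fin.last m))) (hx : x ∈ setS g) (i : Fin m) :
    0 < evalInit g (Fin.init x) i := by
  obtain ⟨s, -, -, hQ⟩ := (mem_setS_iff hG.ne').1 hx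
  exact pos_of_fiberQ_nonpos hm hG hQ i

theorem le_last_of_mem_setS (hm : 1 ≤ m) {x : Fin (d + 1) → ℝ}
    (hG : 0 < eval (Fin.init x) (g (Fin.last m))) (hx : x ∈ setS g) :
    eval (Fin.init x) (g (Fin.last m)) ≤ x (Fin.last d) := by
  obtain ⟨s, hs, hsx, hQ⟩ := (mem_setS_iff hG.ne').1 hx
  exact (le_of_fiberQ_nonpos hm hG hs.le hQ).trans hsx

theorem eval_polyQ_pos_of_notMem_setS (hm : 1 ≤ m) {x : Fin (d + 1) → ℝ}
    (hG : 0 < eval (Fin.init x) (g (Fin.last m))) (hx : 0 ≤ x (Fin.last d)) (hxS : x ∉ setS g) :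
    0 < eval x (polyQ g) := by
  rw [eval_polyQ_eq_fiberQ hG.ne']
  by_contra! hQ
  have hpos := hG.trans_le (le_of_fiberQ_nonpos hm hG hx hQ)
  exact hxS ((mem_setS_iff hG.ne').2 ⟨_, hpos, le_rfl, hQ⟩)

theorem eventually_eval_snoc_polyQ_pos (hm : 1 ≤ m) {x' : Fin d → ℝ}
    (hG : 0 < eval x' (g (Fin.last m))) : ∀ᶠ s in atTop, 0 < eval (snocℝ x' s) (polyQ g) := by
  simpa only [eval_snoc_polyQ hG.ne'] using eventually_fiberQ_pos hm (evalInit g x') hG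

theorem exists_eval_snoc_polyQ_le_neg_one (hm : 1 ≤ m) {x' : Fin d → ℝ}
    (hG : 1 ≤ eval x' (g (Fin.last m))) (hx' : ∀ i, 0 < evalInit g x' i) :
    ∃ s, 0 < s ∧ eval (snocℝ x' s) (polyQ g) ≤ -1 := by
  simpa only [eval_snoc_polyQ (one_pos.trans_le hG).ne'] using exists_fiberQ_le_neg_one hm hG hx'

theorem continuous_eval_snoc (p : MvPolynomial (Fin (d + 1)) ℝ) (x' : Fin d → ℝ) :
    Continuous fun s : ℝ => eval (snocℝ x' s) p :=
  p.continuous_eval.comp (continuous_const.finSnoc continuous_id)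

/-- The map `f`, with arbitrary functions `h` and `P` in place of polynomials. -/
noncomputable def vertMap (g : Fin (m + 1) → MvPolynomial (Fin d) ℝ) (h : (Fin d → ℝ) → ℝ)
    (P : (Fin (d + 1) → ℝ) → ℝ) (x : Fin (d + 1) → ℝ) : Fin (d + 1) → ℝ :=
  snocℝ (Fin.init x) (stretch (h (Fin.init x)) (P x * eval x (polyQ g)) (x (Fin.last d)))

variable {h : (Fin d → ℝ) → ℝ} {P : (Fin (d + 1) → ℝ) → ℝ}

theorem init_vertMap (x : Fin (d + 1) → ℝ) : Fin.init (vertMap g h P x) = Fin.init x := by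
  rw [vertMap, Fin.init_snoc]

theorem vertMap_last (x : Fin (d + 1) → ℝ) :
    vertMap g h P x (Fin.last d) =
      stretch (h (Fin.init x)) (P x * eval x (polyQ g)) (x (Fin.last d)) := by
  rw [vertMap, Fin.snoc_last]

theorem vertMap_snoc (x' : Fin d → ℝ) (s : ℝ) :
    vertMap g h P (snocℝ x' s) =
      snocℝ x' (stretch (h x') (P (snocℝ x' s) * eval (snocℝ x' s) (polyQ g)) s) := by
  rw [vertMap, Fin.init_snoc, Fin.snoc_last]

theorem cyl_inter_subset_image_vertMap (hm : 1 ≤ m) (hG : ∀ x', 1 ≤ eval x' (g (Fin.last m)))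
    (hPc : ∀ x' : Fin d → ℝ, Continuous fun s => P (snocℝ x' s))
    (h_nonneg : ∀ x ∈ setA g, 0 ≤ h (Fin.init x)) (hP : ∀ x ∈ setS g, 1 ≤ P x) :
    cyl (setA g) (eN d) ∩ {x | h (Fin.init x) ≤ x (Fin.last d)} ⊆ vertMap g h P '' setS g := by
  rintro z ⟨hzA, hhz⟩
  have hz := mem_cyl_setA_iff.1 hzA
  have hh := (forall_mem_setA_iff fun x' => 0 ≤ h x').1 h_nonneg _ hz
  obtain ⟨a, ha, hQa⟩ := exists_eval_snoc_polyQ_le_neg_one hm (hG (Fin.init z)) hz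
  have hmem {s : ℝ} (hs : a ≤ s) : snocℝ (Fin.init z) s ∈ setS g :=
    mem_posCyl_eN_iff.2 ⟨a, by rwa [Fin.snoc_last], by
      rw [Fin.init_snoc]
      exact ⟨hQa.trans (by norm_num), by rwa [Fin.snoc_last]⟩⟩
  have hQev := eventually_eval_snoc_polyQ_pos hm (one_pos.trans_le (hG (Fin.init z)))
  obtain ⟨s, hs, hsz⟩ := Ici_subset_image_stretch
    (q := fun s => P (snocℝ (Fin.init z) s) * eval (snocℝ (Fin.init z) s) (polyQ g)) hh
    ((hPc _).mul (continuous_eval_snoc _ _)).continuousOn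
    (by nlinarith [hP _ (hmem le_rfl)])
    (by filter_upwards [hQev, eventually_ge_atTop a] with s hQs hs using
          mul_nonneg (zero_le_one.trans (hP _ (hmem hs))) hQs.le)
    hhz
  dsimp only at hsz
  exact ⟨_, hmem hs, by rw [vertMap_snoc, hsz, Fin.snoc_init_self]⟩

theorem image_vertMap_subset_cyl_inter (hm : 1 ≤ m) (hG : ∀ x', 0 < eval x' (g (Fin.last m)))
    (h_nonneg : ∀ x ∈ setA g, 0 ≤ h (Fin.init x))
    (hgh : ∀ x ∈ setA g, h (Fin.init x) ≤ eval (Fin.init x) (g (Fin.last m))) :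
    vertMap g h P '' setS g ⊆
      cyl (setA g) (eN d) ∩ {x | h (Fin.init x) ≤ 2 * x (Fin.last d)} := by
  rintro _ ⟨x, hx, rfl⟩
  have hx' := evalInit_pos_of_mem_setS hm (hG _) hx
  have hh := (forall_mem_setA_iff fun x' => 0 ≤ h x').1 h_nonneg _ hx'
  have hhG := (forall_mem_setA_iff fun x' => h x' ≤ eval x' (g (Fin.last m))).1 hgh _ hx'
  refine ⟨mem_cyl_setA_iff.2 (by rwa [init_vertMap]), ?_⟩
  rw [mem_ofPred_eq, init_vertMap, vertMap_last]
  exact le_two_mul_stretch hh (hhG.trans (le_last_of_mem_setS hm (hG _) hx))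

theorem posCyl_setA_eq :
    posCyl (setA g) (eN d) = cyl (setA g) (eN d) ∩ {x | 0 ≤ x (Fin.last d)} := by
  ext x
  rw [mem_posCyl_setA_iff, mem_inter_iff, mem_cyl_setA_iff, mem_ofPred_eq]

theorem le_vertMap_last {x : Fin (d + 1) → ℝ} (hx : 0 ≤ x (Fin.last d))
    (hPQ : 0 ≤ P x * eval x (polyQ g)) (hh : 0 ≤ h (Fin.init x)) :
    x (Fin.last d) ≤ vertMap g h P x (Fin.last d) :=
  (le_stretch hh hPQ hx).trans_eq (vertMap_last x).symm

theorem tendsto_vertMap_snoc_last (hm : 1 ≤ m) {x' : Fin d → ℝ}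
    (hG : 0 < eval x' (g (Fin.last m))) (hh : 0 ≤ h x') (hP : ∀ᶠ s in atTop, 0 ≤ P (snocℝ x' s)) :
    Tendsto (fun s => vertMap g h P (snocℝ x' s) (Fin.last d)) atTop atTop := by
  simp only [vertMap_snoc, Fin.snoc_last]
  refine tendsto_stretch hh ?_
  filter_upwards [hP, eventually_eval_snoc_polyQ_pos hm hG] with s hPs hQs
    using mul_nonneg hPs hQs.le

end Fibration

end Pecker

theorem theorem3p5_general {d m : ℕ} (g : Fin (m + 1) → MvPolynomial (Fin d) ℝ) (hm : 1 ≤ m)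
    (hG : ∀ x', 1 ≤ MvPolynomial.eval x' (g (Fin.last m)))
    (h : (Fin d → ℝ) → ℝ) (P : (Fin (d + 1) → ℝ) → ℝ)
    (hPc : ∀ x' : Fin d → ℝ,
      Continuous fun s : ℝ => P (Fin.snoc (α := fun _ => ℝ) x' s : Fin (d + 1) → ℝ))
    (h_nonneg : ∀ x ∈ Pecker.setA g, 0 ≤ h (Fin.init x))
    (hP : ∀ x ∈ Pecker.setS g, 1 ≤ P x)
    (hgh : ∀ x ∈ Pecker.setA g, h (Fin.init x) ≤ MvPolynomial.eval (Fin.init x) (g (Fin.last m))) :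
    (Pecker.cyl (Pecker.setA g) (Pecker.eN d) ∩ {x | h (Fin.init x) ≤ x (Fin.last d)} ⊆
        Pecker.vertMap g h P '' Pecker.setS g ∧
      Pecker.vertMap g h P '' Pecker.setS g ⊆
        Pecker.cyl (Pecker.setA g) (Pecker.eN d) ∩ {x | h (Fin.init x) ≤ 2 * x (Fin.last d)} ∧
      (h = 0 →
        Pecker.vertMap g h P '' Pecker.setS g = Pecker.posCyl (Pecker.setA g) (Pecker.eN d))) ∧
    ((∀ x : Fin (d + 1) → ℝ, 0 ≤ x (Fin.last d) →
        0 ≤ P x * MvPolynomial.eval x (Pecker.polyQ g) →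
        0 ≤ h (Fin.init x) →
        x (Fin.last d) ≤ Pecker.vertMap g h P x (Fin.last d)) ∧
      (∀ x ∈ Pecker.posCyl (Pecker.setA g) (Pecker.eN d) \ Pecker.setS g,
        0 ≤ P x →
        0 ≤ x (Fin.last d) ∧
        0 ≤ P x * MvPolynomial.eval x (Pecker.polyQ g) ∧
        0 ≤ h (Fin.init x) ∧
        x (Fin.last d) ≤ Pecker.vertMap g h P x (Fin.last d))) ∧
    (∀ x' : Fin d → ℝ, 0 ≤ h x' →
      (∀ᶠ s : ℝ in Filter.atTop,
        0 ≤ P (Fin.snoc (α := fun _ => ℝ) x' s : Fin (d + 1) → ℝ)) →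
      Filter.Tendsto
        (fun s : ℝ =>
          Pecker.vertMap g h P (Fin.snoc (α := fun _ => ℝ) x' s : Fin (d + 1) → ℝ) (Fin.last d))
        Filter.atTop Filter.atTop) := by
  have hG0 (x' : Fin d → ℝ) : 0 < MvPolynomial.eval x' (g (Fin.last m)) := one_pos.trans_le (hG x')
  have hsub := Pecker.cyl_inter_subset_image_vertMap hm hG hPc h_nonneg hP
  have hsup := Pecker.image_vertMap_subset_cyl_inter (P := P) hm hG0 h_nonneg hgh
  refine ⟨⟨hsub, hsup, ?_⟩, ⟨fun x => Pecker.le_vertMap_last, fun x hx hPx => ?_⟩,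
    fun x' => Pecker.tendsto_vertMap_snoc_last hm (hG0 x')⟩
  · rintro rfl
    rw [Pecker.posCyl_setA_eq]
    refine (hsup.trans ?_).antisymm hsub
    exact Set.inter_subset_inter_right _ fun x hx => by simpa using hx
  · obtain ⟨hA, hx0⟩ := Pecker.mem_posCyl_setA_iff.1 hx.1
    have hQ := Pecker.eval_polyQ_pos_of_notMem_setS hm (hG0 _) hx0 hx.2
    have hPQ := mul_nonneg hPx hQ.le
    have hh := (Pecker.forall_mem_setA_iff fun x' => 0 ≤ h x').1 h_nonneg _ hA
    exact ⟨hx0, hPQ, hh, Pecker.le_vertMap_last hx0 hPQ hh⟩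

theorem theorem3p5 {d m : ℕ} (g : Fin (m + 1) → MvPolynomial (Fin d) ℝ)
    (hg : Pecker.IsAdmissible g)
    (h : MvPolynomial (Fin d) ℝ) (P : MvPolynomial (Fin (d + 1)) ℝ)
    (h_nonneg : ∀ x ∈ Pecker.setA g, 0 ≤ MvPolynomial.eval (Fin.init x) h)
    (hP : ∀ x ∈ Pecker.setS g, 1 < MvPolynomial.eval x P)
    (hgh : ∀ x ∈ Pecker.setA g,
      MvPolynomial.eval (Fin.init x) h < MvPolynomial.eval (Fin.init x) (g (Fin.last m))) :
    -- (i)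
    (Pecker.cyl (Pecker.setA g) (Pecker.eN d) ∩
          {x | MvPolynomial.eval (Fin.init x) h ≤ x (Fin.last d)} ⊆
        Pecker.mapF g h P '' Pecker.setS g ∧
      Pecker.mapF g h P '' Pecker.setS g ⊆
        Pecker.cyl (Pecker.setA g) (Pecker.eN d) ∩
          {x | MvPolynomial.eval (Fin.init x) h ≤ 2 * x (Fin.last d)} ∧
      (h = 0 →
        Pecker.mapF g h P '' Pecker.setS g = Pecker.posCyl (Pecker.setA g) (Pecker.eN d))) ∧
    -- (ii)
    ((∀ x : Fin (d + 1) → ℝ, 0 ≤ x (Fin.last d) →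
        0 ≤ MvPolynomial.eval x P * MvPolynomial.eval x (Pecker.polyQ g) →
        0 ≤ MvPolynomial.eval (Fin.init x) h →
        x (Fin.last d) ≤ Pecker.mapF g h P x (Fin.last d)) ∧
      (∀ x ∈ Pecker.posCyl (Pecker.setA g) (Pecker.eN d) \ Pecker.setS g,
        0 ≤ MvPolynomial.eval x P →
        0 ≤ x (Fin.last d) ∧
        0 ≤ MvPolynomial.eval x P * MvPolynomial.eval x (Pecker.polyQ g) ∧
        0 ≤ MvPolynomial.eval (Fin.init x) h ∧
        x (Fin.last d) ≤ Pecker.mapF g h P x (Fin.last d))) ∧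
    -- (iii)
    (∀ x' : Fin d → ℝ, 0 ≤ MvPolynomial.eval x' h →
      (∀ᶠ s : ℝ in Filter.atTop,
        0 ≤ MvPolynomial.eval (Fin.snoc (α := fun _ => ℝ) x' s : Fin (d + 1) → ℝ) P) →
      Filter.Tendsto
        (fun s : ℝ =>
          Pecker.mapF g h P (Fin.snoc (α := fun _ => ℝ) x' s : Fin (d + 1) → ℝ) (Fin.last d))
        Filter.atTop Filter.atTop) := by
  have h_main := theorem3p5_general g hg.1 (fun x' => (hg.2 x').le)
    (fun x' => MvPolynomial.eval x' h) (fun x => MvPolynomial.eval x P)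
    (Pecker.continuous_eval_snoc P) h_nonneg (fun x hx => (hP x hx).le) fun x hx => (hgh x hx).le
  exact ⟨⟨h_main.1.1, h_main.1.2.1, fun h0 => h_main.1.2.2 (by simp only [h0, map_zero]; rfl)⟩,
    h_main.2⟩
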